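/- Let $F$ be a finite field with $p^m$ elements, $p$ prime, let $V$ be a vector space over $F$ of finite dimension $\dim(q) = \dim V \ge 1$, let $a \in F$, and let $q : V \to F$ be a non-degenerate quadratic form, i.e. the polar form $b_q(x,y) = q(x+y)-q(x)-q(y)$ has zero radical. Let $\mathcal G_{q,a}$ be the graph with vertex set $V$ in which two distinct vectors $x, y$ are adjacent if and only if $q(x-y)=a$. Its diameter is the supremum in $\mathbb N_0\cup\{\infty\}$ of the distances between vertices, where vertices not joined by a path have distance $\infty$. Call $q$ isotropic if $q(v)=0$ for some $v\neq 0$ and anisotropic otherwise, and let $\mathbb H$ be the hyperbolic plane, i.e. the form $(x,y)\mapsto xy$ on $F^2$. For $p\neq 2$ let $\det(q)\in F^\ast/F^{\ast 2}$ be the class of the determinant of the Gram matrix of $\tfrac12 b_q$ in any basis of $V$ (the class of $a_1\cdots a_n$ if $q$ is isometric to $a_1x_1^2+\dots+a_nx_n^2$); equalities involving $\det(q)$ are in $F^\ast/F^{\ast2}$. (If $\dim(q)$ is odd, then non-degeneracy forces $p\neq 2$.) Then the following hold. 1. If $a=0$, then $\mathsf{diam}(\mathcal G_{q,0})=2$ if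 $q$ is isotropic, and $\mathsf{diam}(\mathcal G_{q,0})=\infty$ if $q$ is anisotropic. 2. If $a\neq 0$ and $\dim(q)=1$, then $\mathsf{diam}(\mathcal G_{q,a})=\frac{p-1}{2}$ if $m=1$ and $a\det(q)=1$, and $\mathsf{diam}(\mathcal G_{q,a})=\infty$ otherwise. 3. If $a\neq 0$, $\dim(q)=2$ and $q\cong\mathbb H$, then $\mathsf{diam}(\mathcal G_{q,a})=\infty$ if $|F|\le 4$, and $\mathsf{diam}(\mathcal G_{q,a})\in\{3,4\}$ if $|F|\ge 5$. 4. If $a\neq 0$, $\dim(q)=2$ and $q\not\cong\mathbb H$, then $\mathsf{diam}(\mathcal G_{q,a})$ is $1$ if $|F|=2$, is $2$ if $|F|\in\{3,4\}$, and is $3$ if $|F|\ge 5$. 5. If $a\neq 0$ and $\dim(q)=3$, then $\mathsf{diam}(\mathcal G_{q,a})=2$ if $\det(q)=-a$, and $\mathsf{diam}(\mathcal G_{q,a})=3$ if $\det(q)\neq -a$. 6. If $a\neq 0$ and $\dim(q)\ge 4$, then $\mathsf{diam}(\mathcal G_{q,a})=2$. -/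

import Mathlib

section RepresentationGraphs

/-- A quadratic form is non-degenerate if the radical of its polar form
`b_q (x, y) = q (x + y) - q x - q y` is zero. -/
def QFNondegenerate {F V : Type*} [Field F] [AddCommGroup V] [Module F V]
    (q : QuadraticForm F V) : Prop :=
  ∀ x : V, (∀ y : V, QuadraticMap.polar q x y = 0) → x = 0

/-- A quadratic form is isotropic if it has a nonzero zero. -/
def QFIsotropic {F V : Type*} [Field F] [AddCommGroup V] [Module F V]
    (q : QuadraticForm F V) : Prop :=
  ∃ v : V, v ≠ 0 ∧ q v = 0

/-- The representation graph of `q` with respect to `a`: two different vectors are adjacent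
if and only if `q` takes the value `a` on their difference. -/
def representationGraph {F V : Type*} [Field F] [AddCommGroup V] [Module F V]
    (q : QuadraticForm F V) (a : F) : SimpleGraph V where
  Adj x y := x ≠ y ∧ q (x - y) = a
  symm := ⟨fun x y h => ⟨h.1.symm, by rw [← neg_sub, QuadraticMap.map_neg]; exact h.2⟩⟩
  loopless := ⟨fun _ h => h.1 rfl⟩

/-- The hyperbolic plane: the quadratic form `(x, y) ↦ x * y` on `F × F`. -/
def hyperbolicPlane (F : Type*) [Field F] : QuadraticForm F (F × F) :=
  QuadraticMap.linMulLin (LinearMap.fst F F F) (LinearMap.snd F F F)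

/-- The congruence "equal up to a nonzero square factor" on the multiplicative monoid of `F`. -/
def squareCon (F : Type*) [Field F] : Con F where
  r x y := ∃ u : F, u ≠ 0 ∧ y = u ^ 2 * x
  iseqv :=
    { refl := fun x => ⟨1, one_ne_zero, by ring⟩
      symm := by
        rintro x y ⟨u, hu, rfl⟩
        exact ⟨u⁻¹, inv_ne_zero hu, by field_simp⟩
      trans := by
        rintro x y z ⟨u, hu, rfl⟩ ⟨v, hv, rfl⟩
        exact ⟨v * u, mul_ne_zero hv hu, by ring⟩ }
  mul' := by
    rintro w x y z ⟨u, hu, rfl⟩ ⟨v, hv, rfl⟩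
    exact ⟨u * v, mul_ne_zero hu hv, by ring⟩

/-- The monoid of square classes of `F`; its nonzero elements form the group of nonzero
elements of `F` modulo nonzero squares. -/
abbrev SquareClass (F : Type*) [Field F] : Type _ := (squareCon F).Quotient

/-- The square class of an element. -/
def squareClass {F : Type*} [Field F] (x : F) : SquareClass F := (x : (squareCon F).Quotient)

/-- The determinant of the Gram matrix, in the basis `b`, of the symmetric bilinear form
`b_q / 2`, whose diagonal is `q`. It is meant for characteristic different from two. -/
noncomputable def gramDet {F V ι : Type*} [Field F] [AddCommGroup V] [Module F V] [Fintype ι] [DecidableEq ι]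
    (q : QuadraticForm F V) (b : Module.Basis ι F V) : F :=
  Matrix.det (Matrix.of fun i j => (2 : F)⁻¹ * QuadraticMap.polar q (b i) (b j))

/-- The determinant of a quadratic form (in characteristic different from two): the square class
of the Gram determinant of `b_q / 2` in any basis. It is the class of `a₁ ⋯ aₙ` if
`q` is isometric to `a₁ x₁² + ⋯ + aₙ xₙ²`. -/
noncomputable def detClass {F V : Type*} [Field F] [AddCommGroup V] [Module F V]
    [FiniteDimensional F V] (q : QuadraticForm F V) : SquareClass F :=
  squareClass (gramDet q (Module.finBasis F V))

theorem squareClass_eq_iff {F : Type*} [Field F] (x y : F) :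
    squareClass x = squareClass y ↔ ∃ u : F, u ≠ 0 ∧ y = u ^ 2 * x :=
  (squareCon F).eq

/-- The determinant does not depend on the basis. -/
theorem detClass_eq {F V : Type*} [Field F] [AddCommGroup V] [Module F V]
    [FiniteDimensional F V] (q : QuadraticForm F V)
    (b : Module.Basis (Fin (Module.finrank F V)) F V) :
    detClass q = squareClass (gramDet q b) := by
  have key : ∀ c : Module.Basis (Fin (Module.finrank F V)) F V, gramDet q c =
      (LinearMap.BilinForm.toMatrix c ((2 : F)⁻¹ • QuadraticMap.polarBilin q)).det := by
    intro c
    unfold gramDet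
    congr 1
    ext i j
    simp [LinearMap.BilinForm.toMatrix_apply]
  unfold detClass
  rw [squareClass_eq_iff, key, key,
    ← LinearMap.BilinForm.toMatrix_mul_basis_toMatrix (Module.finBasis F V) b]
  refine ⟨((Module.finBasis F V).toMatrix b).det, ?_, ?_⟩
  · intro h
    have h2 := congrArg Matrix.det ((Module.finBasis F V).toMatrix_mul_toMatrix_flip b)
    rw [Matrix.det_mul, h, zero_mul, Matrix.det_one] at h2
    exact zero_ne_one h2
  · rw [Matrix.det_mul, Matrix.det_mul, Matrix.det_transpose]
    ring

end RepresentationGraphs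

/-! The graph is the Cayley graph of the group `V` on the nonzero vectors of value `a`, so distances
depend only on `v = x - y`. Since `q (v - w) = q v + q w - polar q v w`, a path of length two
amounts to some `w` with `q w = a` and `polar q v w = q v`: an affine hyperplane must meet a
quadric.

What makes such `w` exist in dimension at least three is universality: over a finite field a form
that is non-degenerate on a subspace of dimension at least two takes every value there
(`exists_mem_map_eq`). In dimension at least four, `v` lies in a non-degenerate plane; its
orthogonal complement has dimension at least two and adjusts the value freely. In dimension three
the midpoint `v / 2` is adjusted inside the orthogonal space of `v`; this fails only for isotropic
`v`, where that space takes one square class of nonzero values, compared with `a` through the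
determinant.

A plane is hyperbolic or anisotropic. The hyperbolic case is a computation on the curve `x * y = a`,
which over fields with at most four elements lies in a proper subgroup. In the anisotropic case
reflections act transitively on each circle `q = c` and show that it has at least `|F| + 1` points,
while a line meets it in at most two; pigeonhole then bounds distances by three.

On a line only `u` and `-u` have value `a`, so the graph is a union of cycles of length `p`. For `a
= 0` everything rests on isotropic vectors. -/

section Lemmas

open QuadraticMap

/-! ### Distances in the Cayley graph -/

section Graph

variable {F V : Type*} [Field F] [AddCommGroup V] [Module F V] {q : QuadraticForm F V} {a : F}

/-- Bounding the distance, instead of asserting adjacency, covers `x = y`, which can occur when `a =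
0`. -/
theorem edist_le_one_of_map_sub_eq {x y : V} (h : q (x - y) = a) :
    (representationGraph q a).edist x y ≤ 1 := by
  rw [SimpleGraph.edist_le_one_iff_adj_or_eq]
  by_cases hxy : x = y
  · exact .inr hxy
  · exact .inl ⟨hxy, h⟩

theorem edist_le_two_of_map_sub_eq {x y w : V} (hw : q w = a) (h : q (x - y - w) = a) :
    (representationGraph q a).edist x y ≤ 2 := by
  calc (representationGraph q a).edist x y
      ≤ (representationGraph q a).edist x (x - w) + (representationGraph q a).edist (x - w) y :=
        SimpleGraph.edist_triangle
    _ ≤ 1 + 1 := add_le_add (edist_le_one_of_map_sub_eq (by simpa using hw))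
        (edist_le_one_of_map_sub_eq (by rwa [sub_right_comm]))
    _ = 2 := one_add_one_eq_two

theorem ediam_le_of_edist_sub_le {k : ℕ∞}
    (h : ∀ v : V, v ≠ 0 → ∀ x y : V, x - y = v → (representationGraph q a).edist x y ≤ k) :
    (representationGraph q a).ediam ≤ k := by
  refine SimpleGraph.ediam_le_of_edist_le fun x y => ?_
  by_cases hxy : x = y
  · simp [hxy]
  · exact h (x - y) (sub_ne_zero.mpr hxy) x y rfl

theorem ediam_le_two (h : ∀ v : V, v ≠ 0 → q v = a ∨ ∃ w, q w = a ∧ q (v - w) = a) :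
    (representationGraph q a).ediam ≤ 2 := by
  refine ediam_le_of_edist_sub_le fun v hv x y hxy => ?_
  subst hxy
  rcases h _ hv with h | ⟨w, hw, h⟩
  · exact (edist_le_one_of_map_sub_eq h).trans (by norm_num)
  · exact edist_le_two_of_map_sub_eq hw h

theorem edist_le_add_one {k : ℕ∞} {x y w : V} (hw : q w = a)
    (h : (representationGraph q a).edist (x - w) y ≤ k) :
    (representationGraph q a).edist x y ≤ k + 1 := by
  calc (representationGraph q a).edist x y
      ≤ (representationGraph q a).edist x (x - w) + (representationGraph q a).edist (x - w) y :=
        SimpleGraph.edist_triangle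
    _ ≤ 1 + k := add_le_add (edist_le_one_of_map_sub_eq (by simpa using hw)) h
    _ = k + 1 := add_comm _ _

theorem two_le_ediam {v : V} (hv : v ≠ 0) (h : q v ≠ a) :
    2 ≤ (representationGraph q a).ediam := by
  refine le_trans ?_ (SimpleGraph.edist_le_ediam (u := v) (v := 0))
  by_contra! hlt
  have h1 : (representationGraph q a).edist v 0 ≤ 1 := Order.le_of_lt_add_one
    (by rwa [one_add_one_eq_two])
  rw [SimpleGraph.edist_le_one_iff_adj_or_eq] at h1
  rcases h1 with h1 | h1
  · exact h (by simpa using h1.2)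
  · exact hv h1

theorem three_le_ediam {v : V} (hv : v ≠ 0) (h : q v ≠ a)
    (h2 : ∀ w, q w = a → q (v - w) ≠ a) :
    3 ≤ (representationGraph q a).ediam := by
  refine le_trans ?_ (SimpleGraph.edist_le_ediam (u := v) (v := 0))
  have : 2 < (representationGraph q a).edist v 0 := by
    rw [SimpleGraph.two_lt_edist_iff]
    refine ⟨hv, fun h1 => h (by simpa using h1.2), ?_⟩
    ext w
    simp only [SimpleGraph.mem_commonNeighbors, Set.mem_empty_iff_false, iff_false, not_and]
    intro hw hw'
    exact h2 w (by simpa using hw'.2) hw.2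
  exact Order.add_one_le_of_lt this

/-- A walk is a sum of vectors of value `a`. Hence a proper subgroup containing all of these
disconnects the graph. -/
theorem sub_mem_of_walk {x y : V} (H : AddSubgroup V) (hH : ∀ v, q v = a → v ∈ H)
    (w : (representationGraph q a).Walk x y) : x - y ∈ H := by
  induction w with
  | nil => simp
  | @cons u v t huv p ih =>
    have := H.add_mem (hH _ huv.2) ih
    simpa using this

theorem ediam_eq_top_of_addSubgroup (H : AddSubgroup V) (hH : ∀ v, q v = a → v ∈ H) {v : V}
    (hv : v ∉ H) : (representationGraph q a).ediam = ⊤ := by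
  refine SimpleGraph.ediam_eq_top_of_not_preconnected fun h => hv ?_
  obtain ⟨w⟩ := h v 0
  simpa using sub_mem_of_walk H hH w

theorem ediam_eq_top_of_forall_ne [Nontrivial V] (h : ∀ v : V, v ≠ 0 → q v ≠ a) :
    (representationGraph q a).ediam = ⊤ := by
  obtain ⟨v, hv⟩ := exists_ne (0 : V)
  refine ediam_eq_top_of_addSubgroup ⊥ (fun w hw => ?_) (v := v) (by simpa using hv)
  by_contra h0
  exact h w (by simpa using h0) hw

theorem sub_eq_zsmul_of_walk {u : V} (hu : ∀ v, q v = a → v = u ∨ v = -u) {x y : V}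
    (w : (representationGraph q a).Walk x y) :
    ∃ j : ℤ, |j| ≤ w.length ∧ x - y = j • u := by
  induction w with
  | nil => exact ⟨0, by simp⟩
  | @cons s v t huv p ih =>
    obtain ⟨j, hj, h⟩ := ih
    have hs : s - t = (s - v) + (v - t) := by abel
    rcases hu _ huv.2 with h1 | h1
    · refine ⟨1 + j, ?_, ?_⟩
      · have := abs_add_le 1 j
        simp only [abs_one] at this
        rw [SimpleGraph.Walk.length_cons]
        push_cast
        linarith
      · rw [hs, h1, h, add_zsmul, one_zsmul]
    · refine ⟨-1 + j, ?_, ?_⟩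
      · have := abs_add_le (-1) j
        simp only [abs_neg, abs_one] at this
        rw [SimpleGraph.Walk.length_cons]
        push_cast
        linarith
      · rw [hs, h1, h, add_zsmul, neg_one_zsmul]

theorem edist_nsmul_le {u : V} (hu : q u = a) (n : ℕ) (x y : V) (h : x - y = n • u) :
    (representationGraph q a).edist x y ≤ n := by
  induction n generalizing x with
  | zero => simp_all [sub_eq_zero]
  | succ n ih =>
    push_cast
    refine edist_le_add_one hu (ih (x - u) ?_)
    rw [sub_right_comm, h, add_smul, one_smul, add_sub_cancel_right]

end Graph

/-! ### Polar form, hyperbolic pairs, and the case `a = 0` -/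

section Basic

variable {F V : Type*} [Field F] [AddCommGroup V] [Module F V] (q : QuadraticForm F V)

theorem map_add_polar (x y : V) : q (x + y) = q x + q y + polar q x y := by
  simp [polar]

theorem map_sub_polar (x y : V) : q (x - y) = q x + q y - polar q x y := by
  rw [sub_eq_add_neg, map_add_polar, polar_neg_right, QuadraticMap.map_neg]; ring

theorem map_smul_sq (t : F) (x : V) : q (t • x) = t ^ 2 * q x := by
  rw [QuadraticMap.map_smul, smul_eq_mul, pow_two]

theorem map_smul_add_smul (s t : F) (x y : V) :
    q (s • x + t • y) = s ^ 2 * q x + s * t * polar q x y + t ^ 2 * q y := by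
  rw [map_add_polar, map_smul_sq, map_smul_sq, polar_smul_left, polar_smul_right]
  simp only [smul_eq_mul]; ring

theorem polar_self_mul (x : V) : polar q x x = 2 * q x := by
  rw [polar_self, two_nsmul, two_mul]

variable {q}

theorem exists_polar_eq_one (hq : QFNondegenerate q) {x : V} (hx : x ≠ 0) :
    ∃ y, polar q x y = 1 := by
  by_contra! h
  refine hx (hq x fun y => ?_)
  by_contra hy
  exact h ((polar q x y)⁻¹ • y) (by rw [polar_smul_right, smul_eq_mul, inv_mul_cancel₀ hy])

/-- An isotropic vector of a non-degenerate form has a hyperbolic partner. -/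
theorem exists_hyperbolic_pair (hq : QFNondegenerate q) {x : V} (hx : x ≠ 0) (hx0 : q x = 0) :
    ∃ y, polar q x y = 1 ∧ q y = 0 := by
  obtain ⟨y, hy⟩ := exists_polar_eq_one hq hx
  refine ⟨y - q y • x, ?_, ?_⟩
  · rw [polar_sub_right, polar_smul_right, polar_self_mul, hx0, hy]; simp
  · rw [map_sub_polar, map_smul_sq, polar_smul_right, polar_comm, hy, hx0]; simp

/-- In an isotropic non-degenerate space no vector of nonzero norm is orthogonal to all
isotropic vectors. -/
theorem exists_isotropic_polar_eq (hq : QFNondegenerate q) (hi : QFIsotropic q) {v : V}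
    (hv : q v ≠ 0) : ∃ w, q w = 0 ∧ polar q v w = q v := by
  suffices h : ∃ w, q w = 0 ∧ polar q v w ≠ 0 by
    obtain ⟨w, hw, hvw⟩ := h
    refine ⟨(q v / polar q v w) • w, by rw [map_smul_sq, hw, mul_zero], ?_⟩
    rw [polar_smul_right, smul_eq_mul, div_mul_cancel₀ _ hvw]
  obtain ⟨e, he, he0⟩ := hi
  obtain ⟨f, hef, hf0⟩ := exists_hyperbolic_pair hq he he0
  have hv0 : v ≠ 0 := by rintro rfl; simp at hv
  obtain ⟨y, hy⟩ := exists_polar_eq_one hq hv0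
  by_contra! h
  have h1 := h e he0
  have h2 := h f hf0
  -- The component of `y` orthogonal to the hyperbolic pair. As `v` is assumed orthogonal to `e` and
  -- `f`, it still pairs to 1 with `z`.
  set z := y - polar q y f • e - polar q y e • f with hz
  have hez : polar q e z = 0 := by
    simp only [hz, polar_sub_right, polar_smul_right, polar_self_mul, smul_eq_mul, he0, hef,
      polar_comm q e y]
    ring
  have hfz : polar q f z = 0 := by
    simp only [hz, polar_sub_right, polar_smul_right, polar_self_mul, smul_eq_mul, hf0, hef,
      polar_comm q f y, polar_comm q f e]
    ring
  have hvz : polar q v z = 1 := by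
    simp only [hz, polar_sub_right, polar_smul_right, smul_eq_mul, h1, h2, hy]
    ring
  clear_value z
  -- The vector `e - q z • f` has value `-q z` and is orthogonal to `z`, so the sum is isotropic,
  -- yet it pairs to 1 with `v`.
  have h3 := h (z + (e - q z • f)) (by
    rw [map_add_polar, map_sub_polar, map_smul_sq, polar_sub_right, polar_smul_right,
      polar_smul_right, polar_comm q z e, polar_comm q z f, hez, hfz, hef, he0, hf0]
    simp)
  rw [polar_add_right, polar_sub_right, polar_smul_right, h1, h2, hvz] at h3
  simp at h3

theorem exists_map_ne_zero [Nontrivial V] (hq : QFNondegenerate q) : ∃ v, q v ≠ 0 := by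
  obtain ⟨v, hv⟩ := exists_ne (0 : V)
  obtain ⟨w, hw⟩ := exists_polar_eq_one hq hv
  by_contra! h
  simp [polar, h] at hw

theorem ediam_zero_of_isotropic [Nontrivial V] (hq : QFNondegenerate q) (hi : QFIsotropic q) :
    (representationGraph q 0).ediam = 2 := by
  apply le_antisymm
  · refine ediam_le_two fun v _ => ?_
    by_cases hv : q v = 0
    · exact .inl hv
    · obtain ⟨w, hw, h⟩ := exists_isotropic_polar_eq hq hi hv
      exact .inr ⟨w, hw, by rw [map_sub_polar, hw, h]; ring⟩
  · obtain ⟨v, hv⟩ := exists_map_ne_zero hq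
    exact two_le_ediam (by rintro rfl; simp at hv) hv

theorem ediam_zero_of_not_isotropic [Nontrivial V] (hi : ¬ QFIsotropic q) :
    (representationGraph q 0).ediam = ⊤ :=
  ediam_eq_top_of_forall_ne fun v hv h => hi ⟨v, hv, h⟩

end Basic

/-! ### Universality over finite fields and dimension at least four -/

section Universal

variable {F V : Type*} [Field F] [AddCommGroup V] [Module F V] {q : QuadraticForm F V}

theorem exists_sq_eq_of_two_eq_zero [Finite F] (h2 : (2 : F) = 0) (x : F) : ∃ y : F, y ^ 2 = x := by
  obtain ⟨y, hy⟩ := FiniteField.isSquare_of_char_two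
    (CharP.ringChar_of_prime_eq_zero Nat.prime_two (by exact_mod_cast h2)) x
  exact ⟨y, by rw [hy, pow_two]⟩

/-- Pigeonhole: `b * x ^ 2` and `d - c * y ^ 2` each take more than half of the values in the field.
-/
theorem exists_mul_sq_add_mul_sq_eq [Finite F] (h2 : (2 : F) ≠ 0) {b c : F} (hb : b ≠ 0)
    (hc : c ≠ 0) (d : F) : ∃ x y : F, b * x ^ 2 + c * y ^ 2 = d := by
  have := Fintype.ofFinite F
  have hodd : Fintype.card F % 2 = 1 := by
    by_contra h
    have h0 : ringChar F = 2 := FiniteField.even_card_iff_char_two.mpr (by omega)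
    have := ringChar.Nat.cast_ringChar (R := F)
    rw [h0] at this
    exact h2 (by exact_mod_cast this)
  obtain ⟨x, y, h⟩ := FiniteField.exists_root_sum_quadratic
    (f := Polynomial.C b * Polynomial.X ^ 2) (g := Polynomial.C c * Polynomial.X ^ 2 - Polynomial.C d)
    (Polynomial.degree_C_mul_X_pow 2 hb)
    (by
      rw [Polynomial.degree_sub_eq_left_of_degree_lt, Polynomial.degree_C_mul_X_pow 2 hc]
      · rfl
      · rw [Polynomial.degree_C_mul_X_pow 2 hc]
        exact lt_of_le_of_lt Polynomial.degree_C_le (by norm_num)) hodd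
  simp only [Polynomial.eval_mul, Polynomial.eval_C, Polynomial.eval_pow, Polynomial.eval_X,
    Polynomial.eval_sub] at h
  exact ⟨x, y, by linear_combination h⟩

/-- Over a finite field a form that is non-degenerate on a subspace of dimension at least two
represents everything on that subspace. -/
theorem exists_mem_map_eq [Finite F] {U : Submodule F V} (hU : 2 ≤ Module.finrank F U)
    (hn : ∀ x ∈ U, (∀ y ∈ U, polar q x y = 0) → x = 0) (c : F) : ∃ u ∈ U, q u = c := by
  have : Nontrivial U := Module.nontrivial_of_finrank_pos (R := F) (by omega)
  by_cases hi : ∃ e ∈ U, e ≠ 0 ∧ q e = 0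
  · obtain ⟨e, heU, he, he0⟩ := hi
    obtain ⟨f, hfU, hf⟩ : ∃ f ∈ U, polar q e f ≠ 0 := by
      by_contra! h
      exact he (hn e heU h)
    -- Along the isotropic direction `e` the value `q (s • e + f)` is affine in `s` with slope
    -- `polar q e f`.
    refine ⟨((c - q f) / polar q e f) • e + f, U.add_mem (U.smul_mem _ heU) hfU, ?_⟩
    rw [map_add_polar, map_smul_sq, polar_smul_left, he0, smul_eq_mul, div_mul_cancel₀ _ hf]
    ring
  · push Not at hi
    obtain ⟨⟨e, heU⟩, he⟩ := exists_ne (0 : U)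
    have he : e ≠ 0 := by simpa using he
    have hqe := hi e heU he
    by_cases h2 : (2 : F) = 0
    · obtain ⟨t, ht⟩ := exists_sq_eq_of_two_eq_zero h2 (c / q e)
      exact ⟨t • e, U.smul_mem _ heU, by rw [map_smul_sq, ht, div_mul_cancel₀ _ hqe]⟩
    · obtain ⟨y, hyU, hy⟩ : ∃ y ∈ U, ∀ t : F, y ≠ t • e := by
        by_contra! h
        have : Module.finrank F U ≤ 1 := finrank_le_one ⟨e, heU⟩ fun ⟨y, hy⟩ => by
          obtain ⟨t, ht⟩ := h y hy
          exact ⟨t, by ext; exact ht.symm⟩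
        omega
      -- One Gram–Schmidt step: on the span of `e` and `f` the form is diagonal.
      set f := y - (polar q e y / (2 * q e)) • e with hf
      have hfU : f ∈ U := U.sub_mem hyU (U.smul_mem _ heU)
      have hqf : q f ≠ 0 := hi f hfU (sub_ne_zero.mpr (hy _))
      have hef : polar q e f = 0 := by
        rw [hf, polar_sub_right, polar_smul_right, polar_self_mul, smul_eq_mul,
          div_mul_cancel₀ _ (mul_ne_zero h2 hqe), sub_self]
      obtain ⟨s, t, h⟩ := exists_mul_sq_add_mul_sq_eq h2 hqe hqf c
      refine ⟨s • e + t • f, U.add_mem (U.smul_mem _ heU) (U.smul_mem _ hfU), ?_⟩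
      rw [map_smul_add_smul, hef, ← h]
      ring

theorem exists_map_eq [Finite F] (hq : QFNondegenerate q) (hV : 2 ≤ Module.finrank F V) (c : F) :
    ∃ u, q u = c := by
  obtain ⟨u, -, hu⟩ := exists_mem_map_eq (q := q) (U := ⊤) (by rwa [finrank_top])
    (fun x _ h => hq x fun y => h y trivial) c
  exact ⟨u, hu⟩

theorem mem_ker_polarBilin_prod {v w x : V} :
    x ∈ LinearMap.ker ((polarBilin q v).prod (polarBilin q w)) ↔
      polar q v x = 0 ∧ polar q w x = 0 := by
  simp

/-- Cramer's rule for the Gram matrix of the polar form on `v`, `w`, whose determinant is `4 * q v *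
q w - polar q v w ^ 2`. -/
theorem exists_orthogonal_decomposition {v w : V}
    (hD : 4 * q v * q w - polar q v w ^ 2 ≠ 0) (y : V) :
    ∃ s t : F, polar q v (y - (s • v + t • w)) = 0 ∧ polar q w (y - (s • v + t • w)) = 0 := by
  refine ⟨(2 * q w * polar q v y - polar q v w * polar q w y) / (4 * q v * q w - polar q v w ^ 2),
    (2 * q v * polar q w y - polar q v w * polar q v y) / (4 * q v * q w - polar q v w ^ 2), ?_, ?_⟩
  all_goals
    simp only [polar_sub_right, polar_add_right, polar_smul_right, polar_self_mul, smul_eq_mul,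
      polar_comm q w v]
    generalize hE : 4 * q v * q w - polar q v w ^ 2 = D at hD ⊢
    field_simp
    rw [← hE]
    ring

variable [FiniteDimensional F V]

/-- As `polar q v v = 2 * q v` is nonzero, `V` splits as the line of `v` plus its orthogonal space,
which is therefore non-degenerate, of dimension at least two, and universal. -/
theorem exists_orthogonal_map_eq [Finite F] (hq : QFNondegenerate q)
    (hV : 3 ≤ Module.finrank F V) {v : V} (hv : 2 * q v ≠ 0) (c : F) :
    ∃ u, polar q v u = 0 ∧ q u = c := by
  have hr := LinearMap.finrank_range_add_finrank_ker (polarBilin q v)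
  have hr' := Submodule.finrank_le (LinearMap.range (polarBilin q v))
  rw [Module.finrank_self] at hr'
  obtain ⟨u, hu, h⟩ := exists_mem_map_eq (q := q) (U := LinearMap.ker (polarBilin q v)) (by omega)
    (fun x hx h => by
      simp only [LinearMap.mem_ker, polarBilin_apply_apply] at hx h
      refine hq x fun y => ?_
      have := h (y - (polar q v y / (2 * q v)) • v) (by
        rw [polar_sub_right, polar_smul_right, polar_self_mul, smul_eq_mul,
          div_mul_cancel₀ _ hv, sub_self])
      simpa [polar_sub_right, polar_smul_right, polar_comm q x v, hx] using this) c
  exact ⟨u, by simpa using hu, h⟩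

theorem finrank_ker_prod_add_two_le (f g : V →ₗ[F] F) :
    Module.finrank F V ≤ Module.finrank F (LinearMap.ker (f.prod g)) + 2 := by
  have hr := LinearMap.finrank_range_add_finrank_ker (f.prod g)
  have hr' := Submodule.finrank_le (LinearMap.range (f.prod g))
  rw [Module.finrank_prod, Module.finrank_self] at hr'
  omega

theorem exists_orthogonal_pair_map_eq [Finite F] (hq : QFNondegenerate q)
    (hV : 4 ≤ Module.finrank F V) {v w : V}
    (hD : 4 * q v * q w - polar q v w ^ 2 ≠ 0) (c : F) :
    ∃ u, polar q v u = 0 ∧ polar q w u = 0 ∧ q u = c := by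
  have hr := finrank_ker_prod_add_two_le (polarBilin q v) (polarBilin q w)
  obtain ⟨u, hu, h⟩ := exists_mem_map_eq (q := q)
    (U := LinearMap.ker ((polarBilin q v).prod (polarBilin q w))) (by omega)
    (fun x hx h => by
      rw [mem_ker_polarBilin_prod] at hx
      refine hq x fun y => ?_
      obtain ⟨s, t, h1, h2⟩ := exists_orthogonal_decomposition hD y
      have := h _ (mem_ker_polarBilin_prod.mpr ⟨h1, h2⟩)
      simpa [polar_sub_right, polar_add_right, polar_smul_right, polar_comm q x v,
        polar_comm q x w, hx.1, hx.2] using this) c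
  rw [mem_ker_polarBilin_prod] at hu
  exact ⟨u, hu.1, hu.2, h⟩

theorem exists_nondegenerate_plane [Finite F] (hq : QFNondegenerate q)
    (hV : 4 ≤ Module.finrank F V) {v : V} (hv : v ≠ 0) :
    ∃ w, 4 * q v * q w - polar q v w ^ 2 ≠ 0 := by
  by_cases h : 2 * q v = 0
  · obtain ⟨w, hw⟩ := exists_polar_eq_one hq hv
    refine ⟨w, ?_⟩
    rw [show 4 * q v * q w - polar q v w ^ 2 = 2 * (2 * q v) * q w - polar q v w ^ 2 by ring, h, hw]
    simp
  · obtain ⟨w, hw, hw1⟩ := exists_orthogonal_map_eq hq (by omega) h 1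
    refine ⟨w, ?_⟩
    have h2 : (2 : F) ≠ 0 := left_ne_zero_of_mul h
    rw [hw, hw1, show 4 * q v * 1 - 0 ^ 2 = 2 * (2 * q v) by ring]
    exact mul_ne_zero h2 h

theorem isotropic_of_four_le [Finite F] (hq : QFNondegenerate q)
    (hV : 4 ≤ Module.finrank F V) : QFIsotropic q := by
  have : Nontrivial V := Module.nontrivial_of_finrank_pos (R := F) (by omega)
  obtain ⟨v, hv⟩ := exists_ne (0 : V)
  obtain ⟨w, hD⟩ := exists_nondegenerate_plane hq hV hv
  obtain ⟨u, hu, hu', h⟩ := exists_orthogonal_pair_map_eq hq hV hD (-q v)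
  refine ⟨v + u, fun h0 => hD ?_, by rw [map_add_polar, hu, h]; ring⟩
  have hvu : u = -v := eq_neg_of_add_eq_zero_right h0
  rw [hvu, polar_neg_right, neg_eq_zero] at hu hu'
  rw [polar_self_mul] at hu
  rw [polar_comm, hu', show 4 * q v * q w = 2 * (2 * q v) * q w by ring, hu]
  simp

theorem ediam_of_four_le [Finite F] (hq : QFNondegenerate q)
    (hV : 4 ≤ Module.finrank F V) {a : F} (ha : a ≠ 0) :
    (representationGraph q a).ediam = 2 := by
  apply le_antisymm
  · refine ediam_le_two fun v hv => .inr ?_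
    obtain ⟨w, hD⟩ := exists_nondegenerate_plane hq hV hv
    -- The pairing with `v` is arranged inside the plane; adding `u` orthogonal to the plane then
    -- corrects the value to `a` without changing the pairing.
    obtain ⟨s, t, hst⟩ : ∃ s t : F, polar q v (s • v + t • w) = q v := by
      by_cases hb : polar q v w = 0
      · have h2 : (2 : F) ≠ 0 := by
          intro h2
          rw [hb, show (4 : F) = 2 * 2 by norm_num, h2] at hD
          simp at hD
        refine ⟨2⁻¹, 0, ?_⟩
        rw [zero_smul, add_zero, polar_smul_right, polar_self_mul, smul_eq_mul,
          inv_mul_cancel_left₀ h2]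
      · refine ⟨0, q v / polar q v w, ?_⟩
        rw [zero_smul, zero_add, polar_smul_right, smul_eq_mul, div_mul_cancel₀ _ hb]
    obtain ⟨u, hu, hu', h⟩ := exists_orthogonal_pair_map_eq hq hV hD (a - q (s • v + t • w))
    have hw : q (s • v + t • w + u) = a := by
      rw [map_add_polar, polar_add_left, polar_smul_left, polar_smul_left, hu, hu', h]
      simp
    refine ⟨s • v + t • w + u, hw, ?_⟩
    rw [map_sub_polar, hw, polar_add_right, hst, hu]
    ring
  · obtain ⟨v, hv, hv0⟩ := isotropic_of_four_le hq hV
    exact two_le_ediam hv (by rw [hv0]; exact ha.symm)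

end Universal

/-! ### Dimension three -/

section Ternary

variable {F V : Type*} [Field F] [AddCommGroup V] [Module F V] {q : QuadraticForm F V}
  [FiniteDimensional F V]

theorem detClass_eq_of_finrank_eq {n : ℕ} (h : Module.finrank F V = n)
    (b : Module.Basis (Fin n) F V) : detClass q = squareClass (gramDet q b) := by
  subst h
  exact detClass_eq q b

theorem two_ne_zero_of_finrank_eq_three (hq : QFNondegenerate q)
    (hV : Module.finrank F V = 3) : (2 : F) ≠ 0 := by
  intro h2
  let b := Module.finBasisOfFinrankEq F V hV
  have hnd : LinearMap.BilinForm.Nondegenerate (polarBilin q) :=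
    ⟨fun x h => hq x h, fun x h => hq x fun y => by rw [polar_comm]; exact h y⟩
  rw [LinearMap.BilinForm.nondegenerate_iff_det_ne_zero b, Matrix.det_fin_three] at hnd
  apply hnd
  simp only [LinearMap.BilinForm.toMatrix_apply, polarBilin_apply_apply, polar_self_mul, h2]
  rw [polar_comm q (b 1) (b 0), polar_comm q (b 2) (b 0), polar_comm q (b 2) (b 1)]
  -- A symmetric 3 × 3 matrix with zero diagonal has determinant twice the product of its
  -- off-diagonal entries.
  linear_combination polar q (b 0) (b 1) * polar q (b 1) (b 2) * polar q (b 0) (b 2) * h2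

theorem isotropic_of_finrank_eq_three [Finite F] (hq : QFNondegenerate q)
    (hV : Module.finrank F V = 3) : QFIsotropic q := by
  have h2 := two_ne_zero_of_finrank_eq_three hq hV
  have : Nontrivial V := Module.nontrivial_of_finrank_pos (R := F) (by omega)
  obtain ⟨v, hv⟩ := exists_map_ne_zero hq
  obtain ⟨u, hu, h⟩ := exists_orthogonal_map_eq hq hV.ge (mul_ne_zero h2 hv) (-q v)
  refine ⟨v + u, fun h0 => ?_, by rw [map_add_polar, hu, h]; ring⟩
  rw [eq_neg_of_add_eq_zero_right h0, polar_neg_right, neg_eq_zero, polar_self_mul] at hu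
  exact mul_ne_zero h2 hv hu

/-- An isotropic vector of a non-degenerate ternary form is part of a basis consisting of a
hyperbolic pair and a vector orthogonal to it, which computes the determinant. -/
theorem exists_orthogonal_detClass (hq : QFNondegenerate q)
    (hV : Module.finrank F V = 3) {v : V} (hv : v ≠ 0) (hv0 : q v = 0) :
    ∃ g, polar q v g = 0 ∧ (∀ u, polar q v u = 0 → ∃ s t : F, u = s • v + t • g) ∧
      detClass q = squareClass (-(q g / 4)) := by
  have h2 := two_ne_zero_of_finrank_eq_three hq hV
  obtain ⟨f, hf, hf0⟩ := exists_hyperbolic_pair hq hv hv0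
  have hr := finrank_ker_prod_add_two_le (polarBilin q v) (polarBilin q f)
  have : Nontrivial (LinearMap.ker ((polarBilin q v).prod (polarBilin q f))) :=
    Module.nontrivial_of_finrank_pos (R := F) (by omega)
  obtain ⟨⟨g, hg⟩, hg0⟩ := exists_ne
    (0 : LinearMap.ker ((polarBilin q v).prod (polarBilin q f)))
  rw [mem_ker_polarBilin_prod] at hg
  obtain ⟨hvg, hfg⟩ := hg
  have hg0 : g ≠ 0 := by simpa using hg0
  have hli : LinearIndependent F ![v, f, g] := by
    rw [Fintype.linearIndependent_iff]
    intro c hc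
    simp only [Fin.sum_univ_three, Matrix.cons_val] at hc
    have h1 := congrArg (polar q v) hc
    have h3 := congrArg (polar q f) hc
    simp only [polar_add_right, polar_smul_right, polar_self_mul, smul_eq_mul, hf, hvg, hfg,
      hv0, hf0, polar_comm q f v, polar_zero_right] at h1 h3
    have h0 : c 1 = 0 := by linear_combination h1
    have h0' : c 0 = 0 := by linear_combination h3
    rw [h0, h0', zero_smul, zero_smul, zero_add, zero_add, smul_eq_zero_iff_left hg0] at hc
    intro i
    fin_cases i <;> assumption
  let b := basisOfLinearIndependentOfCardEqFinrank hli (by simp [hV])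
  have hb : ⇑b = ![v, f, g] := coe_basisOfLinearIndependentOfCardEqFinrank hli (by simp [hV])
  refine ⟨g, hvg, fun u hu => ⟨b.repr u 0, b.repr u 2, ?_⟩, ?_⟩
  · have hsum := b.sum_repr u
    simp only [Fin.sum_univ_three, hb, Matrix.cons_val] at hsum
    have h1 := congrArg (polar q v) hsum
    simp only [polar_add_right, polar_smul_right, polar_self_mul, smul_eq_mul, hf, hvg,
      hv0, hu] at h1
    have h0 : b.repr u 1 = 0 := by linear_combination h1
    conv_lhs => rw [← hsum, h0, zero_smul, add_zero]
  · rw [detClass_eq_of_finrank_eq hV b, gramDet, Matrix.det_fin_three]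
    simp only [Matrix.of_apply, hb, Matrix.cons_val, polar_self_mul, hvg, hfg, hf, hv0, hf0,
      polar_comm q f v, polar_comm q g v, polar_comm q g f]
    congr 1
    rw [show (4 : F) = 2 * 2 by norm_num]
    field_simp
    ring

theorem ediam_of_finrank_eq_three [Finite F] (hq : QFNondegenerate q)
    (hV : Module.finrank F V = 3) {a : F} (ha : a ≠ 0) :
    (detClass q = squareClass (-a) → (representationGraph q a).ediam = 2) ∧
    (detClass q ≠ squareClass (-a) → (representationGraph q a).ediam = 3) := by
  have h2 := two_ne_zero_of_finrank_eq_three hq hV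
  have h4 : (4 : F) ≠ 0 := by
    rw [show (4 : F) = 2 * 2 by norm_num]; exact mul_ne_zero h2 h2
  obtain ⟨z, hz, hz0⟩ := isotropic_of_finrank_eq_three hq hV
  -- Midpoint trick: `v / 2 + u` and `v / 2 - u` add up to `v` and have the same value when `u` is
  -- orthogonal to `v`.
  have hmid : ∀ v u, polar q v u = 0 → q u = a - q v / 4 →
      ∃ w, q w = a ∧ q (v - w) = a := by
    intro v u hu h
    have hv : v - ((2 : F)⁻¹ • v + u) = (2 : F)⁻¹ • v - u := by
      have : v = (2 : F)⁻¹ • v + (2 : F)⁻¹ • v := by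
        rw [← add_smul, ← two_mul, mul_inv_cancel₀ h2, one_smul]
      nth_rewrite 1 [this]
      abel
    have h5 : (2⁻¹ : F) ^ 2 = 1 / 4 := by
      rw [show (4 : F) = 2 * 2 by norm_num]; field_simp
    refine ⟨(2 : F)⁻¹ • v + u, ?_, ?_⟩
    · rw [map_add_polar, map_smul_sq, polar_smul_left, hu, h, h5, smul_zero]; ring
    · rw [hv, map_sub_polar, map_smul_sq, polar_smul_left, hu, h, h5, smul_zero]; ring
  have hmid' : ∀ v, q v ≠ 0 → ∃ w, q w = a ∧ q (v - w) = a := by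
    intro v hv
    obtain ⟨u, hu, h⟩ := exists_orthogonal_map_eq hq hV.ge (mul_ne_zero h2 hv) (a - q v / 4)
    exact hmid v u hu h
  have hlow : ∀ v, q v = 0 → q v ≠ a := fun v hv h => ha (by rw [← h, hv])
  refine ⟨fun hdet => le_antisymm (ediam_le_two fun v hv => .inr ?_)
    (two_le_ediam hz (hlow z hz0)), fun hdet => le_antisymm ?_
    (three_le_ediam hz (hlow z hz0) fun w hw hzw => hdet ?_)⟩
  · by_cases hv0 : q v = 0
    · obtain ⟨g, hg, -, hd⟩ := exists_orthogonal_detClass hq hV hv hv0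
      rw [hd, squareClass_eq_iff] at hdet
      obtain ⟨t, ht, h⟩ := hdet
      -- The determinant condition reads `-a = t ^ 2 * -(q g / 4)`, that is `a = (t / 2) ^ 2 * q g`.
      refine hmid v ((t / 2) • g) (by rw [polar_smul_right, hg, smul_zero]) ?_
      rw [map_smul_sq, hv0]
      rw [show (4 : F) = 2 * 2 by norm_num] at h ⊢
      field_simp at h ⊢
      linear_combination h
    · exact hmid' v hv0
  · refine ediam_le_of_edist_sub_le fun v hv x y hxy => ?_
    subst hxy
    by_cases hv0 : q (x - y) = 0
    · obtain ⟨w, hw⟩ := exists_map_eq hq (by omega) a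
      -- A first step `w` with this property leaves a vector of nonzero value, which two further
      -- steps reach. One of `w`, `-w` always works, since `a ≠ -a`.
      obtain ⟨w, hw, hvw⟩ : ∃ w, q w = a ∧ polar q (x - y) w ≠ a := by
        by_cases h : polar q (x - y) w = a
        · refine ⟨-w, by rw [QuadraticMap.map_neg, hw], ?_⟩
          rw [polar_neg_right, h]
          intro h3
          have : 2 * a = 0 := by linear_combination -h3
          exact mul_ne_zero h2 ha this
        · exact ⟨w, hw, h⟩
      obtain ⟨w', hw', h⟩ := hmid' (x - y - w) (by
        rw [map_sub_polar, hv0, hw]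
        intro h3
        exact hvw (by linear_combination -h3))
      rw [show (3 : ℕ∞) = 2 + 1 by norm_num]
      exact edist_le_add_one hw (edist_le_two_of_map_sub_eq hw' (by rwa [sub_right_comm x w y]))
    · obtain ⟨w, hw, h⟩ := hmid' (x - y) hv0
      exact (edist_le_two_of_map_sub_eq hw h).trans (by norm_num)
  · obtain ⟨g, hg, hspan, hd⟩ := exists_orthogonal_detClass hq hV hz hz0
    rw [map_sub_polar, hz0, hw, zero_add] at hzw
    -- A path of length two to the isotropic `z` forces `w` to be orthogonal to `z`, so `a = q w = t
    -- ^ 2 * q g`, which fixes the determinant.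
    obtain ⟨s, t, hst⟩ := hspan w (by linear_combination -hzw)
    rw [hst, map_smul_add_smul, hz0, hg] at hw
    rw [hd, squareClass_eq_iff]
    have ht : t ≠ 0 := by rintro rfl; apply ha; rw [← hw]; ring
    refine ⟨2 * t, mul_ne_zero h2 ht, ?_⟩
    rw [← hw]
    field_simp
    ring

end Ternary

/-! ### Elements of small finite fields -/

section SmallFields

theorem exists_ne_ne {α : Type*} [Finite α] (h : 3 ≤ Nat.card α) (a b : α) : ∃ c, c ≠ a ∧ c ≠ b := by
  classical
  have := Fintype.ofFinite α
  rw [Nat.card_eq_fintype_card] at h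
  obtain ⟨c, hc⟩ := Finset.exists_mem_notMem_of_card_lt_card (s := {a, b}) (t := Finset.univ)
    (by
      rw [Finset.card_univ]
      have := Finset.card_le_two (a := a) (b := b)
      omega)
  exact ⟨c, by simpa using hc⟩

variable {F : Type*} [Field F] [Finite F]

theorem natCast_card_eq_zero : ((Nat.card F : ℕ) : F) = 0 := by
  have := Fintype.ofFinite F
  rw [Nat.card_eq_fintype_card, FiniteField.cast_card_eq_zero]

theorem pow_natCard (x : F) : x ^ Nat.card F = x := by
  have := Fintype.ofFinite F
  rw [Nat.card_eq_fintype_card, FiniteField.pow_card]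

theorem eq_one_of_natCard_eq_two (h : Nat.card F = 2) {x : F} (hx : x ≠ 0) : x = 1 := by
  have := pow_natCard x
  rw [h] at this
  exact mul_left_cancel₀ hx (by linear_combination this)

theorem two_eq_zero_of_natCard_eq_four (h : Nat.card F = 4) : (2 : F) = 0 := by
  have := natCast_card_eq_zero (F := F)
  rw [h] at this
  have h4 : (2 : F) * 2 = 0 := by push_cast at this; linear_combination this
  simpa using h4

theorem exists_pow_ne {n : ℕ} (hn : 1 < n) (h : n < Nat.card F) : ∃ x : F, x ^ n ≠ x := by
  have hd : (Polynomial.X ^ n - Polynomial.X : Polynomial F).natDegree = n :=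
    FiniteField.X_pow_card_sub_X_natDegree_eq F hn
  obtain ⟨x, hx⟩ := Polynomial.exists_eval_ne_zero_of_natDegree_lt_card
    (Polynomial.X ^ n - Polynomial.X : Polynomial F)
    (by intro h0; rw [h0, Polynomial.natDegree_zero] at hd; omega)
    (by
      rw [hd, ← Nat.cast_card]
      exact_mod_cast h)
  exact ⟨x, fun h => hx (by simp [h])⟩

/-- In characteristic two the conditions follow from `x ^ 4 ≠ x`, in characteristic three from `x ^
3 ≠ x`, because there `x ^ 2 + x + 1 = (x - 1) ^ 2` and `2 * x + 1 = -(x - 1)`. Otherwise `x = 1`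
works. -/
theorem exists_avoiding (h : 5 ≤ Nat.card F) :
    ∃ x : F, x ≠ 0 ∧ x + 1 ≠ 0 ∧ 2 * x + 1 ≠ 0 ∧ x ^ 2 + x + 1 ≠ 0 := by
  by_cases h2 : (2 : F) = 0
  · obtain ⟨x, hx⟩ := exists_pow_ne (F := F) (n := 4) (by norm_num) (by omega)
    have key : x * (x - 1) * (x ^ 2 + x + 1) ≠ 0 := fun h => hx (by linear_combination h)
    refine ⟨x, left_ne_zero_of_mul (left_ne_zero_of_mul key), fun h => ?_, ?_,
      right_ne_zero_of_mul key⟩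
    · exact right_ne_zero_of_mul (left_ne_zero_of_mul key) (by linear_combination h - h2)
    · simp [h2]
  by_cases h3 : (3 : F) = 0
  · obtain ⟨x, hx⟩ := exists_pow_ne (F := F) (n := 3) (by norm_num) (by omega)
    have key : x * (x + 1) * (x - 1) ≠ 0 := fun h => hx (by linear_combination h)
    have h1 := right_ne_zero_of_mul key
    refine ⟨x, left_ne_zero_of_mul (left_ne_zero_of_mul key),
      right_ne_zero_of_mul (left_ne_zero_of_mul key), fun h => h1 ?_, fun h => ?_⟩
    · linear_combination x * h3 - h
    · exact pow_ne_zero 2 h1 (by linear_combination h - x * h3)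
  · refine ⟨1, one_ne_zero, ?_, ?_, ?_⟩
    · rwa [one_add_one_eq_two]
    · norm_num; exact h3
    · norm_num; exact h3

end SmallFields

/-! ### Reflections and lower bounds for anisotropic forms -/

section Reflection

variable {F V : Type*} [Field F] [AddCommGroup V] [Module F V]

/-- The reflection in the hyperplane orthogonal to `u`. -/
noncomputable def reflectIn (q : QuadraticForm F V) (u : V) : V →ₗ[F] V :=
  LinearMap.id - ((q u)⁻¹ • polarBilin q u).smulRight u

variable {q : QuadraticForm F V}

theorem reflectIn_apply (u x : V) :
    reflectIn q u x = x - ((q u)⁻¹ * polar q u x) • u := by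
  simp [reflectIn]

theorem map_reflectIn (u x : V) : q (reflectIn q u x) = q x := by
  rw [reflectIn_apply, map_sub_polar, map_smul_sq, polar_smul_right, polar_comm q x u, smul_eq_mul]
  by_cases hu : q u = 0
  · simp [hu]
  · field_simp; ring

/-- The reflection in `x - y` moves `x` to `y`, in every characteristic, because `polar q (x - y) x
= q (x - y)` when `q x = q y`. -/
theorem exists_isometry_apply_eq (hi : ¬ QFIsotropic q) {x y : V} (h : q x = q y) :
    ∃ g : V →ₗ[F] V, (∀ z, q (g z) = q z) ∧ g x = y := by
  by_cases hxy : x = y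
  · exact ⟨LinearMap.id, fun _ => rfl, hxy⟩
  · have h0 : q (x - y) ≠ 0 := fun h0 => hi ⟨_, sub_ne_zero.mpr hxy, h0⟩
    refine ⟨reflectIn q (x - y), map_reflectIn _, ?_⟩
    have : polar q (x - y) x = q (x - y) := by
      rw [polar_sub_left, polar_self_mul, map_sub_polar, ← h, polar_comm q y x]; ring
    rw [reflectIn_apply, this, inv_mul_cancel₀ h0, one_smul, sub_sub_cancel]

/-- Whether `v` is reached in two steps depends only on `q v`: an isometry carries `w₁ - w₂` to `v`.
-/
theorem exists_add_of_map_sub_eq (hi : ¬ QFIsotropic q) {a : F} {v w₁ w₂ : V} (h₁ : q w₁ = a)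
    (h₂ : q w₂ = a) (h : q (w₁ - w₂) = q v) : ∃ w, q w = a ∧ q (v - w) = a := by
  obtain ⟨g, hg, hgv⟩ := exists_isometry_apply_eq hi h
  refine ⟨g w₁, by rw [hg, h₁], ?_⟩
  rw [← hgv, LinearMap.map_sub, sub_sub_cancel_left, QuadraticMap.map_neg, hg, h₂]

theorem ediam_anisotropic_of_card_eq_two [Finite F] [Nontrivial V] (hi : ¬ QFIsotropic q) {a : F} (ha : a ≠ 0)
    (hF : Nat.card F = 2) : (representationGraph q a).ediam = 1 := by
  apply le_antisymm
  · refine ediam_le_of_edist_sub_le fun v hv x y hxy => edist_le_one_of_map_sub_eq ?_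
    rw [hxy, eq_one_of_natCard_eq_two hF ha]
    exact eq_one_of_natCard_eq_two hF fun h => hi ⟨v, hv, h⟩
  · exact Order.one_le_iff_ne_zero.mpr SimpleGraph.ediam_ne_zero

theorem three_le_ediam_anisotropic [Finite F] (hq : QFNondegenerate q)
    (hi : ¬ QFIsotropic q) (hV : Module.finrank F V = 2) {a : F} (ha : a ≠ 0)
    (hF : 5 ≤ Nat.card F) : 3 ≤ (representationGraph q a).ediam := by
  obtain ⟨x, hx, hx1, hx2, hx3⟩ := exists_avoiding hF
  have h0 : x * (x + 1) ≠ 0 := mul_ne_zero hx hx1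
  -- If `q w = a` and `polar q v w = q v`, then `q (T • v + w) = q v * (T ^ 2 + T) + a`. This value
  -- of `q v` gives the quadratic the distinct roots `x` and `-1 - x`, which an anisotropic form
  -- forbids.
  obtain ⟨v, hv⟩ := exists_map_eq hq hV.ge (-a / (x * (x + 1)))
  have hv' : q v * (x * (x + 1)) = -a := by rw [hv, div_mul_cancel₀ _ h0]
  have hv0 : v ≠ 0 := by rintro rfl; simp at hv'; exact ha hv'
  refine three_le_ediam hv0 (fun h => ?_) fun w hw hvw => ?_
  · rw [h] at hv'
    have : a * (x ^ 2 + x + 1) = 0 := by linear_combination hv'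
    exact mul_ne_zero ha hx3 this
  · have hb : polar q v w = q v := by
      rw [map_sub_polar, hw] at hvw
      linear_combination -hvw
    have hzero : ∀ u, q u = 0 → u = 0 := fun u hu => by
      by_contra h
      exact hi ⟨u, h, hu⟩
    have h1 := hzero (x • v + (1 : F) • w) (by
      rw [map_smul_add_smul, hb, hw]; linear_combination hv')
    have h2 := hzero ((-1 - x) • v + (1 : F) • w) (by
      rw [map_smul_add_smul, hb, hw]; linear_combination hv')
    have h3 : (2 * x + 1) • v = 0 := by
      have : (2 * x + 1) • v = (x • v + (1 : F) • w) - ((-1 - x) • v + (1 : F) • w) := by module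
      rw [this, h1, h2, sub_zero]
    rcases smul_eq_zero.mp h3 with h | h
    exacts [hx2 h, hv0 h]

theorem two_le_ediam_anisotropic [Finite F] (hq : QFNondegenerate q)
    (hV : Module.finrank F V = 2) {a : F}
    (hF : 3 ≤ Nat.card F) : 2 ≤ (representationGraph q a).ediam := by
  obtain ⟨c, hc, hca⟩ := exists_ne_ne hF 0 a
  obtain ⟨v, hv⟩ := exists_map_eq hq hV.ge c
  exact two_le_ediam (v := v) (fun h => hc (by rw [← hv, h, QuadraticMap.map_zero])) (by rwa [hv])

end Reflection

/-! ### Counting points on circles in an anisotropic plane -/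

section AnisotropicPlane

variable {F V : Type*} [Field F] [AddCommGroup V] [Module F V] [FiniteDimensional F V]
  {q : QuadraticForm F V}

theorem exists_generator_orthogonal (hq : QFNondegenerate q) (hV : Module.finrank F V = 2) {v : V}
    (hv : v ≠ 0) : ∃ e, e ≠ 0 ∧ ∀ x, polar q v x = 0 → ∃ t : F, x = t • e := by
  have hr := LinearMap.finrank_range_add_finrank_ker (polarBilin q v)
  obtain ⟨y, hy⟩ := exists_polar_eq_one hq hv
  have hsurj : LinearMap.range (polarBilin q v) = ⊤ := by
    rw [LinearMap.range_eq_top]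
    exact fun c => ⟨c • y, by simp [hy]⟩
  rw [hsurj, finrank_top, Module.finrank_self, hV] at hr
  obtain ⟨⟨e, he⟩, he0, h⟩ := finrank_eq_one_iff'.mp
    (show Module.finrank F (LinearMap.ker (polarBilin q v)) = 1 by omega)
  refine ⟨e, by simpa using he0, fun x hx => ?_⟩
  obtain ⟨t, ht⟩ := h ⟨x, by simpa using hx⟩
  exact ⟨t, (congrArg Subtype.val ht).symm⟩

/-- A line meets a circle in at most two points. -/
theorem card_line_inter_le_two [Fintype V] [DecidableEq V] [DecidableEq F]
    (hq : QFNondegenerate q) (hi : ¬ QFIsotropic q)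
    (hV : Module.finrank F V = 2) {v : V} (hv : v ≠ 0) (a c : F) :
    (Finset.univ.filter fun x => q x = a ∧ polar q v x = c).card ≤ 2 := by
  rcases (Finset.univ.filter fun x => q x = a ∧ polar q v x = c).eq_empty_or_nonempty with h | ⟨x, hx⟩
  · simp [h]
  obtain ⟨e, he0, he⟩ := exists_generator_orthogonal hq hV hv
  have hqe : q e ≠ 0 := fun h => hi ⟨e, he0, h⟩
  refine (Finset.card_le_card fun y hy => ?_).trans (Finset.card_le_two (a := x)
    (b := reflectIn q e x))
  simp only [Finset.mem_filter, Finset.mem_univ, true_and] at hx hy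
  obtain ⟨t, ht⟩ := he (y - x) (by rw [polar_sub_right, hx.2, hy.2, sub_self])
  have hyx : y = x + t • e := by rw [← ht]; abel
  have h := hy.1
  rw [hyx, map_add_polar, map_smul_sq, polar_smul_right, smul_eq_mul, hx.1] at h
  have h0 : t * (t * q e + polar q x e) = 0 := by linear_combination h
  rw [Finset.mem_insert, Finset.mem_singleton]
  rcases mul_eq_zero.mp h0 with h0 | h0
  · left; rw [hyx, h0, zero_smul, add_zero]
  · right
    rw [hyx, reflectIn_apply, sub_eq_add_neg, ← neg_smul, polar_comm q e x]
    congr 2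
    field_simp
    linear_combination h0

/-- Equal images make multiples of `u` and `u'` agree, so both are orthogonal to `v`; but the
vectors orthogonal to `v` form a line. -/
theorem reflectIn_ne_of_independent (hq : QFNondegenerate q)
    (hi : ¬ QFIsotropic q) (hV : Module.finrank F V = 2) {v u u' : V} (hv : v ≠ 0)
    (h : ∀ s t : F, s • u = t • u' → s = 0 ∧ t = 0) : reflectIn q u v ≠ reflectIn q u' v := by
  intro heq
  have hu : u ≠ 0 := fun hu => one_ne_zero (h 1 0 (by simp [hu])).1
  have hu' : u' ≠ 0 := fun hu => one_ne_zero (h 0 1 (by simp [hu])).2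
  have hqu : q u ≠ 0 := fun h => hi ⟨u, hu, h⟩
  have hqu' : q u' ≠ 0 := fun h => hi ⟨u', hu', h⟩
  rw [reflectIn_apply, reflectIn_apply, sub_right_inj] at heq
  obtain ⟨h1, h2⟩ := h _ _ heq
  have h1 := (mul_eq_zero.mp h1).resolve_left (inv_ne_zero hqu)
  have h2 := (mul_eq_zero.mp h2).resolve_left (inv_ne_zero hqu')
  obtain ⟨e, -, he⟩ := exists_generator_orthogonal hq hV hv
  obtain ⟨s, hs⟩ := he u (by rw [polar_comm, h1])
  obtain ⟨t, ht⟩ := he u' (by rw [polar_comm, h2])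
  obtain ⟨h3, -⟩ := h t s (by rw [hs, ht, smul_smul, smul_smul, mul_comm])
  exact hu' (by rw [ht, h3, zero_smul])

/-- Reflecting `w` in the `|F| + 1` directions of the plane gives distinct points of its circle. The
directions are those of `w` and of `e + t • w`. -/
theorem card_add_one_le_card_circle [Fintype F] [Fintype V] [DecidableEq F]
    (hq : QFNondegenerate q) (hi : ¬ QFIsotropic q)
    (hV : Module.finrank F V = 2) {w : V} (hw : w ≠ 0) :
    Fintype.card F + 1 ≤ (Finset.univ.filter fun x => q x = q w).card := by
  classical
  obtain ⟨e, he⟩ : ∃ e : V, ∀ t : F, t • w ≠ e := by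
    by_contra! h
    have := finrank_le_one w h
    omega
  have hind : ∀ s t : F, s • e = t • w → s = 0 ∧ t = 0 := by
    intro s t h
    have hs : s = 0 := by
      by_contra hs
      exact he (s⁻¹ * t) (by rw [mul_smul, ← h, inv_smul_smul₀ hs])
    rw [hs, zero_smul, eq_comm, smul_eq_zero_iff_left hw] at h
    exact ⟨hs, h⟩
  have hind1 : ∀ t s r : F, s • (e + t • w) = r • w → s = 0 ∧ r = 0 := by
    intro t s r h
    obtain ⟨hs, h1⟩ := hind s (r - s * t) (by rw [sub_smul, ← h]; module)
    exact ⟨hs, by rw [hs] at h1; simpa using h1⟩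
  let f : Option F → V := fun o => o.elim (reflectIn q w w) fun t => reflectIn q (e + t • w) w
  have hf : Function.Injective f := by
    rintro (_ | t) (_ | t') h
    · rfl
    · exact (reflectIn_ne_of_independent hq hi hV hw (hind1 t') h.symm).elim
    · exact (reflectIn_ne_of_independent hq hi hV hw (hind1 t) h).elim
    · by_contra hne
      have hne : t ≠ t' := fun h => hne (by rw [h])
      refine reflectIn_ne_of_independent hq hi hV hw (fun s r h => ?_) h
      obtain ⟨h1, h2⟩ := hind (s - r) (r * t' - s * t) (by
        have : s • e + (s * t) • w = r • e + (r * t') • w := by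
          simpa [smul_add, smul_smul] using h
        rw [sub_smul, sub_smul, sub_eq_sub_iff_add_eq_add, this, add_comm])
      have h3 : r * (t' - t) = 0 := by linear_combination h2 + t * h1
      have hr := (mul_eq_zero.mp h3).resolve_right (sub_ne_zero.mpr hne.symm)
      exact ⟨by linear_combination h1 + hr, hr⟩
  rw [← Fintype.card_option, ← Finset.card_univ, ← Finset.card_image_of_injective _ hf]
  refine Finset.card_le_card fun x hx => ?_
  obtain ⟨o, -, rfl⟩ := Finset.mem_image.mp hx
  rw [Finset.mem_filter]
  refine ⟨Finset.mem_univ _, ?_⟩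
  rcases o with _ | t
  exacts [map_reflectIn _ _, map_reflectIn _ _]

/-- On a circle, fixing `q (v - x)` fixes `polar q v x`, so each fibre lies on a line and has at
most two points. -/
theorem card_subset_circle_le [Fintype V] [DecidableEq F]
    (hq : QFNondegenerate q) (hi : ¬ QFIsotropic q)
    (hV : Module.finrank F V = 2) {v : V} (hv : v ≠ 0) {a : F} {S : Finset V}
    (hS : ∀ x ∈ S, q x = a) : S.card ≤ 2 * (S.image fun x => q (v - x)).card := by
  classical
  refine Finset.card_le_mul_card_image S 2 fun c _ => ?_
  refine (Finset.card_le_card fun x hx => ?_).trans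
    (card_line_inter_le_two hq hi hV hv a (q v + a - c))
  rw [Finset.mem_filter] at hx
  obtain ⟨hx, hc⟩ := hx
  rw [map_sub_polar, hS x hx] at hc
  rw [Finset.mem_filter]
  exact ⟨Finset.mem_univ _, hS x hx, by rw [← hc]; ring⟩

variable [Finite F]

theorem ediam_anisotropic_le_three (hq : QFNondegenerate q)
    (hi : ¬ QFIsotropic q) (hV : Module.finrank F V = 2) {a : F} (ha : a ≠ 0) :
    (representationGraph q a).ediam ≤ 3 := by
  classical
  have := Fintype.ofFinite F
  have : Finite V := Module.finite_of_finite F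
  have := Fintype.ofFinite V
  refine ediam_le_of_edist_sub_le fun v hv x y hxy => ?_
  subst hxy
  obtain ⟨w, hw⟩ := exists_map_eq hq hV.ge a
  have hw0 : w ≠ 0 := by rintro rfl; simp at hw; exact ha hw.symm
  let S : Finset V := Finset.univ.filter fun x => q x = q w
  have hS : ∀ x ∈ S, q x = q w := by simp [S]
  have hcard : Fintype.card F + 1 ≤ S.card := card_add_one_le_card_circle hq hi hV hw0
  have h1 := card_subset_circle_le hq hi hV hv hS
  have h2 := card_subset_circle_le hq hi hV hw0 hS
  -- Each image has at least `(|F| + 1) / 2` elements, so they meet. A common value means that after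
  -- the step `z` the remaining vector has the value of a difference of two points of the circle.
  have hnd : ¬ Disjoint (S.image fun z => q ((x - y) - z)) (S.image fun z => q (w - z)) := by
    intro hd
    have := Finset.card_union_of_disjoint hd
    have := Finset.card_le_univ ((S.image fun z => q ((x - y) - z)) ∪ (S.image fun z => q (w - z)))
    omega
  obtain ⟨c, hc1, hc2⟩ := Finset.not_disjoint_iff.mp hnd
  obtain ⟨z, hz, hzc⟩ := Finset.mem_image.mp hc1
  obtain ⟨z', hz', hzc'⟩ := Finset.mem_image.mp hc2
  obtain ⟨w', hw', h⟩ := exists_add_of_map_sub_eq hi (a := a) (v := x - y - z) hw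
    ((hS z' hz').trans hw) (hzc'.trans hzc.symm)
  rw [show (3 : ℕ∞) = 2 + 1 by norm_num]
  exact edist_le_add_one ((hS z hz).trans hw)
    (edist_le_two_of_map_sub_eq hw' (by rwa [sub_right_comm x z y]))

theorem ediam_anisotropic_of_card_eq_three (hq : QFNondegenerate q)
    (hi : ¬ QFIsotropic q) (hV : Module.finrank F V = 2) {a : F} (ha : a ≠ 0)
    (hF : Nat.card F = 3) : (representationGraph q a).ediam = 2 := by
  classical
  have := Fintype.ofFinite F
  have : Finite V := Module.finite_of_finite F
  have := Fintype.ofFinite V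
  refine le_antisymm (ediam_le_two fun v hv => ?_) (two_le_ediam_anisotropic hq hV hF.ge)
  by_cases hva : q v = a
  · exact .inl hva
  right
  obtain ⟨w, hw⟩ := exists_map_eq hq hV.ge a
  have hw0 : w ≠ 0 := by rintro rfl; simp at hw; exact ha hw.symm
  have hcard := card_add_one_le_card_circle hq hi hV hw0
  rw [← Nat.card_eq_fintype_card, hF] at hcard
  obtain ⟨z, hz, hz'⟩ := Finset.exists_mem_notMem_of_card_lt_card (s := {w, -w})
    (t := Finset.univ.filter fun x => q x = q w) (Finset.card_le_two.trans_lt (by omega))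
  simp only [Finset.mem_filter, Finset.mem_univ, true_and, Finset.mem_insert,
    Finset.mem_singleton, not_or] at hz hz'
  rw [hw] at hz
  have h3 : (3 : F) = 0 := by
    have := natCast_card_eq_zero (F := F)
    rw [hF] at this
    exact_mod_cast this
  have key : ∀ c : F, c ≠ 0 → c ≠ a → c = -a := by
    intro c hc hca
    have h1 := pow_natCard c
    have h2 := pow_natCard a
    rw [hF] at h1 h2
    have h1 : c ^ 2 = 1 := mul_left_cancel₀ hc (by linear_combination h1)
    have h2 : a ^ 2 = 1 := mul_left_cancel₀ ha (by linear_combination h2)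
    have h3 : (c - a) * (c + a) = 0 := by linear_combination h1 - h2
    exact eq_neg_of_add_eq_zero_left ((mul_eq_zero.mp h3).resolve_left (sub_ne_zero.mpr hca))
  refine exists_add_of_map_sub_eq hi hw hz ?_
  rw [key (q v) (fun h => hi ⟨v, hv, h⟩) hva]
  -- If `q (w - z) = a`, then `polar q w z = a` and `q (w + z) = 3 * a = 0`, which forces `z = -w`.
  refine key _ (fun h => hi ⟨_, sub_ne_zero.mpr (Ne.symm hz'.1), h⟩) fun h => ?_
  refine hi ⟨w + z, fun h => hz'.2 (eq_neg_of_add_eq_zero_right h), ?_⟩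
  rw [map_sub_polar, hw, hz] at h
  rw [map_add_polar, hw, hz]
  linear_combination a * h3 - h

theorem ediam_anisotropic_of_card_eq_four (hq : QFNondegenerate q)
    (hi : ¬ QFIsotropic q) (hV : Module.finrank F V = 2) {a : F} (ha : a ≠ 0)
    (hF : Nat.card F = 4) : (representationGraph q a).ediam = 2 := by
  classical
  have := Fintype.ofFinite F
  have : Finite V := Module.finite_of_finite F
  have := Fintype.ofFinite V
  refine le_antisymm (ediam_le_two fun v hv => ?_) (two_le_ediam_anisotropic hq hV (by omega))
  by_cases hva : q v = a
  · exact .inl hva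
  right
  obtain ⟨w, hw⟩ := exists_map_eq hq hV.ge a
  have hw0 : w ≠ 0 := by rintro rfl; simp at hw; exact ha hw.symm
  have hcard := card_add_one_le_card_circle hq hi hV hw0
  rw [← Nat.card_eq_fintype_card, hF] at hcard
  have h2 := two_eq_zero_of_natCard_eq_four hF
  have hzero : ∀ u, q u = 0 → u = 0 := fun u hu => by
    by_contra h
    exact hi ⟨u, h, hu⟩
  let S : Finset V := (Finset.univ.filter fun x => q x = q w).erase w
  have hS : ∀ x ∈ S, q x = a := fun x hx => by
    simp only [S, Finset.mem_erase, Finset.mem_filter] at hx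
    rw [hx.2.2, hw]
  have hcardS : 4 ≤ S.card := by
    rw [Finset.card_erase_of_mem (by simp)]
    omega
  have himg := card_subset_circle_le hq hi hV hw0 hS
  -- The image has at least two elements and the right side exactly two, so every value other than 0
  -- and `a` is attained.
  have hsub : (S.image fun x => q (w - x)) ⊆ (Finset.univ.erase 0).erase a := by
    intro c hc
    obtain ⟨z, hz, rfl⟩ := Finset.mem_image.mp hc
    have hzw : z ≠ w := Finset.ne_of_mem_erase hz
    rw [Finset.mem_erase, Finset.mem_erase]
    refine ⟨fun h => ?_, fun h => hzw (sub_eq_zero.mp (hzero _ h)).symm, Finset.mem_univ _⟩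
    rw [map_sub_polar, hw, hS z hz] at h
    have hb : polar q w z = a := by linear_combination -h
    -- Here `x` is a primitive cube root of unity; `x` and `x + 1` are both roots of `T ^ 2 + T +
    -- 1`, and `q (T • w + z) = a * (T ^ 2 + T + 1)`.
    obtain ⟨x, hx, hx1⟩ := exists_ne_ne (α := F) (by omega) 0 1
    have hpow := pow_natCard x
    rw [hF] at hpow
    have hroot : x ^ 2 + x + 1 = 0 :=
      mul_left_cancel₀ (mul_ne_zero hx (sub_ne_zero.mpr hx1)) (by linear_combination hpow)
    have h3 := hzero (x • w + (1 : F) • z) (by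
      rw [map_smul_add_smul, hb, hw, hS z hz]; linear_combination a * hroot)
    have h4 := hzero ((x + 1) • w + (1 : F) • z) (by
      rw [map_smul_add_smul, hb, hw, hS z hz]; linear_combination a * hroot + a * (x + 1) * h2)
    apply hw0
    have : w = ((x + 1) • w + (1 : F) • z) - (x • w + (1 : F) • z) := by module
    rw [this, h3, h4, sub_zero]
  have heq := Finset.eq_of_subset_of_card_le hsub (by
    rw [Finset.card_erase_of_mem (by simpa using ha), Finset.card_erase_of_mem (by simp),
      Finset.card_univ, ← Nat.card_eq_fintype_card, hF]
    omega)
  have hmem : q v ∈ (Finset.univ.erase 0).erase a := by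
    rw [Finset.mem_erase, Finset.mem_erase]
    exact ⟨hva, fun h => hv (hzero v h), Finset.mem_univ _⟩
  rw [← heq] at hmem
  obtain ⟨z, hz, h⟩ := Finset.mem_image.mp hmem
  exact exists_add_of_map_sub_eq hi hw (hS z hz) h

end AnisotropicPlane

/-! ### The hyperbolic plane -/

section HyperbolicPlane

variable {F V : Type*} [Field F] [AddCommGroup V] [Module F V] {q : QuadraticForm F V}

theorem equivalent_hyperbolicPlane_of_isotropic [FiniteDimensional F V] (hq : QFNondegenerate q)
    (hi : QFIsotropic q) (hV : Module.finrank F V = 2) :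
    QuadraticMap.Equivalent q (hyperbolicPlane F) := by
  obtain ⟨v, hv, hv0⟩ := hi
  obtain ⟨f, hf, hf0⟩ := exists_hyperbolic_pair hq hv hv0
  let g : (F × F) →ₗ[F] V :=
    (LinearMap.toSpanSingleton F V v).coprod (LinearMap.toSpanSingleton F V f)
  have hg : ∀ x, g x = x.1 • v + x.2 • f := fun x => by simp [g]
  have hinj : Function.Injective g := by
    rw [← LinearMap.ker_eq_bot, LinearMap.ker_eq_bot']
    intro x hx
    rw [hg] at hx
    have h1 := congrArg (polar q v) hx
    have h2 := congrArg (polar q f) hx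
    simp only [polar_add_right, polar_smul_right, polar_self_mul, smul_eq_mul, hf, hv0, hf0,
      polar_comm q f v, polar_zero_right] at h1 h2
    ext
    · simpa using h2
    · simpa using h1
  refine QuadraticMap.Equivalent.symm
    ⟨⟨LinearMap.linearEquivOfInjective g hinj (by simp [hV]), fun x => ?_⟩⟩
  change q (g x) = x.1 * x.2
  rw [hg, map_smul_add_smul, hv0, hf, hf0]
  ring

variable {a : F}

theorem edist_isotropic_le_three [Finite F] (e : V ≃ₗ[F] F × F)
    (he : ∀ v, q v = (e v).1 * (e v).2) (hF : 5 ≤ Nat.card F) {x y : V}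
    (h1 : (e (x - y)).1 ≠ 0) (h2 : (e (x - y)).2 = 0) :
    (representationGraph q a).edist x y ≤ 3 := by
  obtain ⟨t, ht, ht1, -, ht2⟩ := exists_avoiding hF
  -- Three points `(r, a / r)` must add up to `(c, 0)`. With first coordinates `k * t` and `k`, the
  -- third must be `c - k * (t + 1)`, and the vanishing sum of reciprocals is this equation for `k`.
  obtain ⟨k, hk⟩ : ∃ k, k * (t ^ 2 + t + 1) = (e (x - y)).1 * (t + 1) :=
    ⟨_, div_mul_cancel₀ _ ht2⟩
  have hk0 : k ≠ 0 := by
    rintro rfl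
    rw [zero_mul] at hk
    exact mul_ne_zero h1 ht1 hk.symm
  have hw₁ : q (e.symm (k * t, a / (k * t))) = a := by
    rw [he, e.apply_symm_apply, mul_div_cancel₀ _ (mul_ne_zero hk0 ht)]
  have hw₂ : q (e.symm (k, a / k)) = a := by
    rw [he, e.apply_symm_apply, mul_div_cancel₀ _ hk0]
  rw [show (3 : ℕ∞) = 2 + 1 by norm_num]
  refine edist_le_add_one hw₁ (edist_le_two_of_map_sub_eq hw₂ ?_)
  rw [sub_right_comm x _ y, he, map_sub e, map_sub e (x - y), e.apply_symm_apply,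
    e.apply_symm_apply]
  simp only [Prod.fst_sub, Prod.snd_sub, h2]
  field_simp
  linear_combination a * hk

theorem edist_hyperbolic_le_four [Finite F] (e : V ≃ₗ[F] F × F)
    (he : ∀ v, q v = (e v).1 * (e v).2) (hF : 5 ≤ Nat.card F) {x y : V}
    (hxy : x - y ≠ 0) : (representationGraph q a).edist x y ≤ 4 := by
  have he' : ∀ v, q v = ((e ≪≫ₗ LinearEquiv.prodComm F F F) v).1 *
      ((e ≪≫ₗ LinearEquiv.prodComm F F F) v).2 := fun v => by
    rw [he]; simp [mul_comm]
  by_cases h1 : (e (x - y)).1 = 0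
  · refine (edist_isotropic_le_three _ he' hF (fun h2 => ?_) (by simpa using h1)).trans
      (by norm_num)
    exact hxy (e.map_eq_zero_iff.mp (Prod.ext h1 (by simpa using h2)))
  · by_cases h : q (x - y) = a
    · exact (edist_le_one_of_map_sub_eq h).trans (by norm_num)
    -- This step cancels the first coordinate and leaves a nonzero isotropic vector.
    · have hw : q (e.symm ((e (x - y)).1, a / (e (x - y)).1)) = a := by
        rw [he, e.apply_symm_apply, mul_div_cancel₀ _ h1]
      rw [show (4 : ℕ∞) = 3 + 1 by norm_num]
      refine edist_le_add_one hw (edist_isotropic_le_three _ he' hF ?_ ?_)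
      · rw [sub_right_comm x _ y, LinearEquiv.trans_apply, map_sub e, e.apply_symm_apply]
        simp only [LinearEquiv.prodComm_apply, Prod.fst_swap, Prod.snd_sub]
        intro h2
        apply h
        rw [he, sub_eq_zero.mp h2, mul_div_cancel₀ _ h1]
      · rw [sub_right_comm x _ y, LinearEquiv.trans_apply, map_sub e, e.apply_symm_apply]
        simp

theorem three_le_ediam_hyperbolic (e : V ≃ₗ[F] F × F)
    (he : ∀ v, q v = (e v).1 * (e v).2) (ha : a ≠ 0) : 3 ≤ (representationGraph q a).ediam := by
  refine three_le_ediam (v := e.symm (1, 0)) (by simp) ?_ fun w hw hvw => ha ?_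
  · rw [he, e.apply_symm_apply, mul_zero]
    exact ha.symm
  · rw [he] at hw hvw
    rw [map_sub, e.apply_symm_apply] at hvw
    simp only [Prod.fst_sub, Prod.snd_sub] at hvw
    rw [← hw]
    have : (e w).2 = 0 := by linear_combination hw - hvw
    rw [this, mul_zero]

theorem ediam_hyperbolic [Finite F] (e : V ≃ₗ[F] F × F)
    (he : ∀ v, q v = (e v).1 * (e v).2) (ha : a ≠ 0) (hF : 5 ≤ Nat.card F) :
    (representationGraph q a).ediam = 3 ∨ (representationGraph q a).ediam = 4 := by
  have h1 := three_le_ediam_hyperbolic e he ha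
  have h2 : (representationGraph q a).ediam ≤ 4 := ediam_le_of_edist_sub_le fun v hv x y hxy =>
    edist_hyperbolic_le_four e he hF (by rwa [hxy])
  generalize (representationGraph q a).ediam = d at h1 h2
  obtain ⟨n, rfl⟩ := ENat.ne_top_iff_exists.mp (ne_top_of_le_ne_top (by norm_num) h2)
  norm_cast at *
  omega

theorem ediam_hyperbolic_eq_top [Finite F] (e : V ≃ₗ[F] F × F)
    (he : ∀ v, q v = (e v).1 * (e v).2) (ha : a ≠ 0) (hF : Nat.card F ≤ 4) :
    (representationGraph q a).ediam = ⊤ := by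
  have h1 : 1 < Nat.card F := Finite.one_lt_card
  have hx : ∀ v, q v = a → (e v).1 ≠ 0 := fun v hv h => ha (by rw [← hv, he, h, zero_mul])
  by_cases h4 : Nat.card F = 4
  · have h2 := two_eq_zero_of_natCard_eq_four h4
    -- For `|F| = 4` nonzero elements satisfy `r⁻¹ = r ^ 2`, so the curve `r * s = a` lies on `s = a
    -- * r ^ 2`, which is a subgroup because squaring is additive.
    let H : AddSubgroup V :=
      { carrier := {v | (e v).2 = a * (e v).1 ^ 2}
        zero_mem' := by simp
        add_mem' := fun {v w} hv hw => by
          simp only [Set.mem_ofPred_eq, map_add, Prod.fst_add, Prod.snd_add] at *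
          linear_combination hv + hw - a * (e v).1 * (e w).1 * h2
        neg_mem' := fun {v} hv => by
          simp only [Set.mem_ofPred_eq, map_neg, Prod.fst_neg, Prod.snd_neg] at *
          linear_combination hv - (e v).2 * h2 }
    refine ediam_eq_top_of_addSubgroup H (fun v hv => ?_) (v := e.symm (0, 1)) (by simp [H])
    change (e v).2 = a * (e v).1 ^ 2
    have hp := pow_natCard (e v).1
    rw [h4] at hp
    have h3 : (e v).1 ^ 3 = 1 := mul_left_cancel₀ (hx v hv) (by linear_combination hp)
    rw [← hv, he]
    linear_combination -(e v).2 * h3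
  · have hsq : ∀ x : F, x ≠ 0 → x ^ 2 = 1 := by
      intro x hx
      have hp := pow_natCard x
      obtain h | h : Nat.card F = 2 ∨ Nat.card F = 3 := by omega
      · rw [eq_one_of_natCard_eq_two h hx, one_pow]
      · rw [h] at hp
        exact mul_left_cancel₀ hx (by linear_combination hp)
    -- For `|F| ≤ 3` nonzero elements are their own inverses, so the curve lies on the line `s = a *
    -- r`.
    let H : AddSubgroup V :=
      { carrier := {v | (e v).2 = a * (e v).1}
        zero_mem' := by simp
        add_mem' := fun {v w} hv hw => by
          simp only [Set.mem_ofPred_eq, map_add, Prod.fst_add, Prod.snd_add] at *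
          linear_combination hv + hw
        neg_mem' := fun {v} hv => by
          simp only [Set.mem_ofPred_eq, map_neg, Prod.fst_neg, Prod.snd_neg] at *
          linear_combination -hv }
    refine ediam_eq_top_of_addSubgroup H (fun v hv => ?_) (v := e.symm (0, 1)) (by simp [H])
    change (e v).2 = a * (e v).1
    rw [← hv, he]
    linear_combination -(e v).2 * hsq _ (hx v hv)

end HyperbolicPlane

/-! ### Dimension one -/

section Unary

variable {F V : Type*} [Field F] [AddCommGroup V] [Module F V] {q : QuadraticForm F V}

theorem squareClass_mul_eq_one_iff (a d : F) :
    squareClass a * squareClass d = 1 ↔ ∃ t : F, t ≠ 0 ∧ 1 = t ^ 2 * (a * d) :=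
  squareClass_eq_iff (a * d) 1

theorem two_ne_zero_of_finrank_eq_one (hq : QFNondegenerate q) (hV : Module.finrank F V = 1) :
    (2 : F) ≠ 0 := by
  intro h2
  obtain ⟨v, hv, h⟩ := finrank_eq_one_iff'.mp hV
  refine hv (hq v fun y => ?_)
  obtain ⟨c, rfl⟩ := h y
  rw [polar_smul_right, polar_self_mul, h2, zero_mul, smul_zero]

theorem eq_or_eq_neg_of_finrank_eq_one (hV : Module.finrank F V = 1) {u v : V} (hu : q u ≠ 0)
    (h : q v = q u) : v = u ∨ v = -u := by
  have hu0 : u ≠ 0 := by rintro rfl; simp at hu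
  obtain ⟨c, rfl⟩ := (finrank_eq_one_iff_of_nonzero' u hu0).mp hV v
  rw [map_smul_sq] at h
  have : c ^ 2 = 1 := mul_right_cancel₀ hu (by rw [h, one_mul])
  rcases sq_eq_sq_iff_eq_or_eq_neg.mp (this.trans (one_pow 2).symm) with h | h
  · left; rw [h, one_smul]
  · right; rw [h, neg_one_smul]

variable [FiniteDimensional F V]

/-- A unary form represents `a` if and only if its determinant is the class of `a`. -/
theorem squareClass_mul_detClass_eq_one_iff (hq : QFNondegenerate q)
    (hV : Module.finrank F V = 1) {a : F} (ha : a ≠ 0) :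
    squareClass a * detClass q = 1 ↔ ∃ u, q u = a := by
  have h2 := two_ne_zero_of_finrank_eq_one hq hV
  let b := Module.finBasisOfFinrankEq F V hV
  have hb : ∀ v, v = b.repr v 0 • b 0 := fun v => by
    conv_lhs => rw [← b.sum_repr v, Fin.sum_univ_one]
  have hdet : gramDet q b = q (b 0) := by
    rw [gramDet, Matrix.det_fin_one, Matrix.of_apply, polar_self_mul, inv_mul_cancel_left₀ h2]
  rw [detClass_eq_of_finrank_eq hV b, hdet, squareClass_mul_eq_one_iff]
  constructor
  · rintro ⟨t, -, h⟩
    refine ⟨(t * a) • b 0, ?_⟩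
    rw [map_smul_sq]
    linear_combination -a * h
  · rintro ⟨u, hu⟩
    rw [hb u, map_smul_sq] at hu
    have hc : b.repr u 0 ≠ 0 := fun h => ha (by rw [← hu, h]; ring)
    have hd : q (b 0) ≠ 0 := fun h => ha (by rw [← hu, h]; ring)
    refine ⟨(b.repr u 0 * q (b 0))⁻¹, inv_ne_zero (mul_ne_zero hc hd), ?_⟩
    rw [← hu]
    field_simp

theorem natCast_prime_eq_zero [Finite F] {p m : ℕ} (hF : Nat.card F = p ^ m) : (p : F) = 0 := by
  have := natCast_card_eq_zero (F := F)
  rw [hF, Nat.cast_pow] at this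
  exact eq_zero_of_pow_eq_zero this

theorem ediam_unary_of_prime [Finite F] {p : ℕ} (hp : p.Prime) (hF : Nat.card F = p)
    (hq : QFNondegenerate q) (hV : Module.finrank F V = 1) {u : V} (hu : q u ≠ 0) :
    (representationGraph q (q u)).ediam = (((p - 1) / 2 : ℕ) : ℕ∞) := by
  have := Fact.mk hp
  have hu0 : u ≠ 0 := by rintro rfl; simp at hu
  have hp0 : (p : F) = 0 := natCast_prime_eq_zero (m := 1) (by rw [hF, pow_one])
  have hodd : p ≠ 2 := by
    rintro rfl
    exact two_ne_zero_of_finrank_eq_one hq hV (by exact_mod_cast hp0)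
  have hodd := hp.eq_two_or_odd.resolve_left hodd
  have hpu : p • u = 0 := by rw [← Nat.cast_smul_eq_nsmul F, hp0, zero_smul]
  have hord : addOrderOf u = p := addOrderOf_eq_prime hpu hu0
  have hcard : Nat.card V = p := by
    rw [Module.natCard_eq_pow_finrank (K := F), hV, pow_one, hF]
  have hpZ : (p : ℤ) = 2 * (((p - 1) / 2 : ℕ) : ℤ) + 1 := by omega
  set n := (p - 1) / 2
  apply le_antisymm
  · refine ediam_le_of_edist_sub_le fun v _ x y hxy => ?_
    obtain ⟨j, hj⟩ := AddSubgroup.mem_zmultiples_iff.mp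
      (mem_zmultiples_of_prime_card hcard hu0 (g' := v))
    have hj' : (j % p : ℤ) • u = v := by
      rw [← hj, ← hord, mod_addOrderOf_zsmul]
    have hr0 := Int.emod_nonneg j (b := (p : ℤ)) (by omega)
    have hr1 := Int.emod_lt_of_pos j (b := (p : ℤ)) (by omega)
    generalize (j % p : ℤ) = r at hj' hr0 hr1
    -- The vertices form a cycle of length `p = 2 * n + 1`; the shorter way round uses `u` or `-u`.
    by_cases hr : r ≤ n
    · obtain ⟨k, rfl⟩ := Int.eq_ofNat_of_zero_le hr0
      refine (edist_nsmul_le rfl k x y (by rw [hxy, ← hj', natCast_zsmul])).trans ?_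
      exact_mod_cast hr
    · obtain ⟨k, hk⟩ := Int.eq_ofNat_of_zero_le (show 0 ≤ p - r by omega)
      refine (edist_nsmul_le (u := -u) (QuadraticMap.map_neg q u) k x y ?_).trans ?_
      · have hr : r = p - k := by omega
        rw [hxy, ← hj', hr, sub_smul, natCast_zsmul, natCast_zsmul, hpu, zero_sub, smul_neg]
      · have : k ≤ n := by omega
        exact_mod_cast this
  · refine le_trans ?_ (SimpleGraph.edist_le_ediam (u := n • u) (v := 0))
    by_contra! hlt
    obtain ⟨w, hw⟩ := SimpleGraph.exists_walk_of_edist_ne_top hlt.ne_top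
    rw [← hw] at hlt
    have hlt : w.length < n := by exact_mod_cast hlt
    -- A walk shorter than `n` gives `n • u = j • u` with `|j| < n`, so `p` would divide `n - j`,
    -- which lies strictly between 0 and `2 * n < p`.
    obtain ⟨j, hj, h⟩ := sub_eq_zsmul_of_walk
      (fun v hv => eq_or_eq_neg_of_finrank_eq_one hV hu hv) w
    rw [sub_zero, ← natCast_zsmul, ← sub_eq_zero, ← sub_smul,
      ← addOrderOf_dvd_iff_zsmul_eq_zero, hord] at h
    have hj := abs_le.mp hj
    have := Int.le_of_dvd (by omega) h
    omega

/-- The multiples of `u` number at most `p`, fewer than the `p ^ m` vectors, and they contain every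
vector of value `q u`. -/
theorem ediam_unary_of_not_prime [Finite F] {p m : ℕ} (hp : p.Prime) (hF : Nat.card F = p ^ m)
    (hm : m ≠ 1) (hV : Module.finrank F V = 1) {u : V} (hu : q u ≠ 0) :
    (representationGraph q (q u)).ediam = ⊤ := by
  have : Finite V := Module.finite_of_finite F
  have hcard : Nat.card V = p ^ m := by
    rw [Module.natCard_eq_pow_finrank (K := F), hV, pow_one, hF]
  have hm1 : 1 < m := by
    have := Finite.one_lt_card (α := F)
    rw [hF] at this
    rcases m with _ | _ | m
    · simp at this
    · omega
    · omega
  have hne : AddSubgroup.zmultiples u ≠ ⊤ := by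
    intro h
    have h1 : Nat.card (AddSubgroup.zmultiples u) = p ^ m := by
      rw [h, AddSubgroup.card_top, hcard]
    rw [Nat.card_zmultiples] at h1
    have h2 : addOrderOf u ≤ p := addOrderOf_le_of_nsmul_eq_zero hp.pos
      (by rw [← Nat.cast_smul_eq_nsmul F, natCast_prime_eq_zero hF, zero_smul])
    have h3 := Nat.pow_lt_pow_right hp.one_lt hm1
    rw [pow_one] at h3
    omega
  obtain ⟨v, hv⟩ : ∃ v, v ∉ AddSubgroup.zmultiples u := by
    by_contra! h
    exact hne (eq_top_iff.mpr fun v _ => h v)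
  refine ediam_eq_top_of_addSubgroup _ (fun w hw => ?_) hv
  rcases eq_or_eq_neg_of_finrank_eq_one hV hu hw with rfl | rfl
  · exact AddSubgroup.mem_zmultiples _
  · exact neg_mem (AddSubgroup.mem_zmultiples _)

end Unary

end Lemmas

/-! ### Assembly of the cases -/

theorem theorem3p1 {F V : Type*} [Field F] [Finite F] [AddCommGroup V] [Module F V]
    [FiniteDimensional F V] [Nontrivial V] (p m : ℕ) (hp : p.Prime) (hF : Nat.card F = p ^ m)
    (q : QuadraticForm F V) (hq : QFNondegenerate q) (a : F) :
    (a = 0 →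
      (QFIsotropic q → (representationGraph q a).ediam = 2) ∧
      (¬ QFIsotropic q → (representationGraph q a).ediam = ⊤)) ∧
    (a ≠ 0 →
      (Module.finrank F V = 1 →
        (squareClass a * detClass q = 1 ∧ m = 1 →
          (representationGraph q a).ediam = (((p - 1) / 2 : ℕ) : ℕ∞)) ∧
        (¬ (squareClass a * detClass q = 1 ∧ m = 1) →
          (representationGraph q a).ediam = ⊤)) ∧
      (Module.finrank F V = 2 →
        (QuadraticMap.Equivalent q (hyperbolicPlane F) →
          (Nat.card F ≤ 4 → (representationGraph q a).ediam = ⊤) ∧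
          (5 ≤ Nat.card F →
            (representationGraph q a).ediam = 3 ∨ (representationGraph q a).ediam = 4)) ∧
        (¬ QuadraticMap.Equivalent q (hyperbolicPlane F) →
          (Nat.card F = 2 → (representationGraph q a).ediam = 1) ∧
          (Nat.card F = 3 ∨ Nat.card F = 4 → (representationGraph q a).ediam = 2) ∧
          (5 ≤ Nat.card F → (representationGraph q a).ediam = 3))) ∧
      (Module.finrank F V = 3 →
        (detClass q = squareClass (-a) → (representationGraph q a).ediam = 2) ∧
        (detClass q ≠ squareClass (-a) → (representationGraph q a).ediam = 3)) ∧
      (4 ≤ Module.finrank F V → (representationGraph q a).ediam = 2)) := by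
  refine ⟨?_, fun ha => ⟨fun hV => ⟨?_, ?_⟩, fun hV => ⟨?_, fun hne => ?_⟩,
    fun hV => ediam_of_finrank_eq_three hq hV ha, fun hV => ediam_of_four_le hq hV ha⟩⟩
  · rintro rfl
    exact ⟨ediam_zero_of_isotropic hq, ediam_zero_of_not_isotropic⟩
  · rintro ⟨h, rfl⟩
    obtain ⟨u, rfl⟩ := (squareClass_mul_detClass_eq_one_iff hq hV ha).mp h
    exact ediam_unary_of_prime hp (by rw [hF, pow_one]) hq hV ha
  · intro h
    rw [squareClass_mul_detClass_eq_one_iff hq hV ha] at h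
    by_cases hu : ∃ u, q u = a
    · obtain ⟨u, rfl⟩ := hu
      exact ediam_unary_of_not_prime hp hF (fun hm => h ⟨⟨u, rfl⟩, hm⟩) hV ha
    · exact ediam_eq_top_of_forall_ne fun v _ hv => hu ⟨v, hv⟩
  · rintro ⟨e⟩
    have he : ∀ v, q v = (e.toLinearEquiv v).1 * (e.toLinearEquiv v).2 :=
      fun v => (e.map_app v).symm
    exact ⟨ediam_hyperbolic_eq_top _ he ha, ediam_hyperbolic _ he ha⟩
  · have hi : ¬ QFIsotropic q := fun hi => hne (equivalent_hyperbolicPlane_of_isotropic hq hi hV)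
    refine ⟨ediam_anisotropic_of_card_eq_two hi ha, fun h => ?_, fun h => le_antisymm
      (ediam_anisotropic_le_three hq hi hV ha) (three_le_ediam_anisotropic hq hi hV ha h)⟩
    rcases h with h | h
    · exact ediam_anisotropic_of_card_eq_three hq hi hV ha h
    · exact ediam_anisotropic_of_card_eq_four hq hi hV ha h
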